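/- Let $\nu>0$. For $c=(c_1,c_2,c_3)\in\mathbb R^3$ consider the equation $$\nu(1-y^2)U'(y)+2\nu y\,U(y)+\tfrac12U(y)^2=c_1(1-y)+c_2(1+y)+c_3(1-y^2),\qquad(*)$$ for $C^1$ functions $U$ on open subintervals of $(-1,1)$. Put $$\bar c_3(c_1,c_2;\nu)=-\tfrac12\bigl(\sqrt{\nu^2+c_1}+\sqrt{\nu^2+c_2}\bigr)\bigl(\sqrt{\nu^2+c_1}+\sqrt{\nu^2+c_2}+2\nu\bigr),$$ $$J_\nu=\{c\in\mathbb R^3:\ c_1\ge-\nu^2,\ c_2\ge-\nu^2,\ c_3\ge\bar c_3(c_1,c_2;\nu)\},$$ $$\tau_1=2\nu-2\sqrt{\nu^2+c_1},\quad \tau_2=2\nu+2\sqrt{\nu^2+c_1},\quad \tau_1'=-2\nu-2\sqrt{\nu^2+c_2},\quad \tau_2'=-2\nu+2\sqrt{\nu^2+c_2}.$$ Let $\gamma^-(c)$ and $\gamma^+(c)$ be the infimum and the supremum of the values $U(0)$ of the global solutions $U$ of $(*)$, i.e. the solutions on all of $(-1,1)$; let $U^{c,\gamma}$ be the global solution with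 $U^{c,\gamma}(0)=\gamma$; and put $U^\pm=U^{c,\gamma^\pm(c)}$. Let $c\in J_\nu$. Then these objects are well defined: $\gamma^-(c)\le\gamma^+(c)$ are real numbers, and for every $\gamma\in[\gamma^-(c),\gamma^+(c)]$ there is exactly one global solution $U^{c,\gamma}$ of $(*)$ with $U^{c,\gamma}(0)=\gamma$. Moreover, let $-1\le y_0<y_1\le1$ and let $U$ be a solution of $(*)$ whose maximal interval of existence in $(-1,1)$ is $(y_0,y_1)$, i.e. which does not extend to a solution on a strictly larger open subinterval of $(-1,1)$. Then exactly one of the following holds. (a) $y_0=-1$, $y_1=1$, and $U=U^{c,\gamma}$ on $(-1,1)$ for some $\gamma\in[\gamma^-(c),\gamma^+(c)]$. In this case the limits of $U$ at $\pm1$ exist and are finite: $\lim_{y\to-1^+}U(y)$ is $\tau_2$ if $\gamma=\gamma^+(c)$ and $\tau_1$ otherwise, and $\lim_{y\to1^-}U(y)$ is $\tau_1'$ if $\gamma=\gamma^-(c)$ and $\tau_2'$ otherwise. (b) $-1=y_0<y_1<1$, $U<U^-$ on $(-1,y_1)$, $\lim_{y\to-1^+}U(y)=\tau_1$ and $\lim_{y\to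 y_1^-}U(y)=-\infty$. (c) $-1<y_0<y_1=1$, $U>U^+$ on $(y_0,1)$, $\lim_{y\to1^-}U(y)=\tau_2'$ and $\lim_{y\to y_0^+}U(y)=+\infty$. -/

import Mathlib

open Set Filter Topology

noncomputable section

namespace NoSwirl

/-- The polynomial `P_c(y) = c₁ (1 - y) + c₂ (1 + y) + c₃ (1 - y²)`, where `c = (c₁, c₂, c₃)`. -/
def P (c : ℝ × ℝ × ℝ) (y : ℝ) : ℝ :=
  c.1 * (1 - y) + c.2.1 * (1 + y) + c.2.2 * (1 - y ^ 2)

/-- `U` is a `C¹` solution on the open interval `(a, b)` of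
`ν (1 - y²) U' + 2 ν y U + U² / 2 = P_c(y)`. Values of `U` outside `(a, b)` play no role. -/
def IsSolutionOn (ν : ℝ) (c : ℝ × ℝ × ℝ) (U : ℝ → ℝ) (a b : ℝ) : Prop :=
  ContDiffOn ℝ 1 U (Ioo a b) ∧
    ∀ y ∈ Ioo a b, ν * (1 - y ^ 2) * deriv U y + 2 * ν * y * U y + (1 / 2) * U y ^ 2 = P c y

/-- `U` is a solution whose domain (maximal interval of existence) in `(-1, 1)` is `(y₀, y₁)`:
no solution on a strictly larger subinterval of `(-1, 1)` extends it. -/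
def IsMaximalSolution (ν : ℝ) (c : ℝ × ℝ × ℝ) (U : ℝ → ℝ) (y₀ y₁ : ℝ) : Prop :=
  -1 ≤ y₀ ∧ y₀ < y₁ ∧ y₁ ≤ 1 ∧ IsSolutionOn ν c U y₀ y₁ ∧
    ∀ (a b : ℝ) (V : ℝ → ℝ), -1 ≤ a → a ≤ y₀ → y₁ ≤ b → b ≤ 1 →
      IsSolutionOn ν c V a b → EqOn V U (Ioo y₀ y₁) → a = y₀ ∧ b = y₁

/-- The critical value `c̄₃(c₁, c₂; ν)`. -/
def c3bar (ν c₁ c₂ : ℝ) : ℝ :=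
  -(1 / 2) * (√(ν ^ 2 + c₁) + √(ν ^ 2 + c₂)) * (√(ν ^ 2 + c₁) + √(ν ^ 2 + c₂) + 2 * ν)

/-- The parameter set `J_ν`. -/
def J (ν : ℝ) : Set (ℝ × ℝ × ℝ) :=
  {c | -ν ^ 2 ≤ c.1 ∧ -ν ^ 2 ≤ c.2.1 ∧ c3bar ν c.1 c.2.1 ≤ c.2.2}

/-- `τ₁ = 2ν - 2 √(ν² + c₁)`. -/
def tau1 (ν : ℝ) (c : ℝ × ℝ × ℝ) : ℝ := 2 * ν - 2 * √(ν ^ 2 + c.1)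

/-- `τ₂ = 2ν + 2 √(ν² + c₁)`. -/
def tau2 (ν : ℝ) (c : ℝ × ℝ × ℝ) : ℝ := 2 * ν + 2 * √(ν ^ 2 + c.1)

/-- `τ₁' = -2ν - 2 √(ν² + c₂)`. -/
def tau1' (ν : ℝ) (c : ℝ × ℝ × ℝ) : ℝ := -2 * ν - 2 * √(ν ^ 2 + c.2.1)

/-- `τ₂' = -2ν + 2 √(ν² + c₂)`. -/
def tau2' (ν : ℝ) (c : ℝ × ℝ × ℝ) : ℝ := -2 * ν + 2 * √(ν ^ 2 + c.2.1)

/-- The set of values at `y = 0` of the global solutions, i.e. of the solutions on `(-1, 1)`. -/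
def globalValues (ν : ℝ) (c : ℝ × ℝ × ℝ) : Set ℝ :=
  {γ | ∃ U : ℝ → ℝ, IsSolutionOn ν c U (-1) 1 ∧ U 0 = γ}

/-- `γ⁻(c)`, the smallest value at `0` of a global solution. -/
def gammaMinus (ν : ℝ) (c : ℝ × ℝ × ℝ) : ℝ := sInf (globalValues ν c)

/-- `γ⁺(c)`, the largest value at `0` of a global solution. -/
def gammaPlus (ν : ℝ) (c : ℝ × ℝ × ℝ) : ℝ := sSup (globalValues ν c)

open Classical in
/-- `U^{c,γ}`, the global solution with value `γ` at `0` (the zero function if there is none).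
Only its values on `(-1, 1)` are meaningful. -/
def globalSol (ν : ℝ) (c : ℝ × ℝ × ℝ) (γ : ℝ) : ℝ → ℝ :=
  if h : ∃ U : ℝ → ℝ, IsSolutionOn ν c U (-1) 1 ∧ U 0 = γ then h.choose else 0

/-- The lower solution `U⁻ = U^{c,γ⁻(c)}`. -/
def lowerSol (ν : ℝ) (c : ℝ × ℝ × ℝ) : ℝ → ℝ := globalSol ν c (gammaMinus ν c)

/-- The upper solution `U⁺ = U^{c,γ⁺(c)}`. -/
def upperSol (ν : ℝ) (c : ℝ × ℝ × ℝ) : ℝ → ℝ := globalSol ν c (gammaPlus ν c)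

open Classical in
/-- The global case: `U = U^{c,γ}` on `(-1, 1)` for some `γ ∈ [γ⁻(c), γ⁺(c)]`, with the boundary
values at `±1` that correspond to `γ`. -/
def CaseGlobal (ν : ℝ) (c : ℝ × ℝ × ℝ) (U : ℝ → ℝ) (y₀ y₁ : ℝ) : Prop :=
  y₀ = -1 ∧ y₁ = 1 ∧ ∃ γ ∈ Icc (gammaMinus ν c) (gammaPlus ν c),
    EqOn U (globalSol ν c γ) (Ioo (-1) 1) ∧
    Tendsto U (𝓝[>] (-1)) (𝓝 (if γ = gammaPlus ν c then tau2 ν c else tau1 ν c)) ∧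
    Tendsto U (𝓝[<] 1) (𝓝 (if γ = gammaMinus ν c then tau1' ν c else tau2' ν c))

/-- The case of a local solution on `(-1, y₁)` that blows up to `-∞` at `y₁ < 1`. -/
def CaseLeft (ν : ℝ) (c : ℝ × ℝ × ℝ) (U : ℝ → ℝ) (y₀ y₁ : ℝ) : Prop :=
  y₀ = -1 ∧ -1 < y₁ ∧ y₁ < 1 ∧ (∀ y ∈ Ioo y₀ y₁, U y < lowerSol ν c y) ∧
    Tendsto U (𝓝[>] (-1)) (𝓝 (tau1 ν c)) ∧ Tendsto U (𝓝[<] y₁) atBot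

/-- The case of a local solution on `(y₀, 1)` that blows up to `+∞` at `y₀ > -1`. -/
def CaseRight (ν : ℝ) (c : ℝ × ℝ × ℝ) (U : ℝ → ℝ) (y₀ y₁ : ℝ) : Prop :=
  -1 < y₀ ∧ y₀ < 1 ∧ y₁ = 1 ∧ (∀ y ∈ Ioo y₀ y₁, upperSol ν c y < U y) ∧
    Tendsto U (𝓝[<] 1) (𝓝 (tau2' ν c)) ∧ Tendsto U (𝓝[>] y₀) atTop

end NoSwirl

end

noncomputable section

namespace NoSwirl

/-! The equation is of Riccati type, so one global solution yields all others by a quadrature. The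
substitution `U = 2ν(1 - y²) w'/w` makes it linear, and `w = (1+y)^((1+A)/2) (1-y)^((1+B)/2)
ψ((1+y)/2)`, with `νA = √(ν²+c₁)` and `νB = √(ν²+c₂)`, turns it into a hypergeometric equation for
`ψ`. Its parameters have product `κ = (c₃ - c̄₃)/(2ν²)`. On `J_ν` this is nonnegative, so the power
series of `ψ` has nonnegative coefficients, `ψ ≥ 1`, and `w` has no zero: a global solution `V` with
limit `τ₂` at `-1` exists (`exists_isUpper`).

With `G = w²/(1-y²)` and `F' = 1/(2νw²)`, every other solution is `V + 1/(G(F+K))`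
(`IsUpper.eqOn_or_exists`). Since `F` increases from `-∞`, the sign and the zero of `F+K` decide
everything: a solution reaching `-1` has `F+K < 0`, so it lies below `V` and tends to `τ₁`; a
maximal one not reaching `-1` starts at the zero of `F+K`, blows up to `+∞` there and lies above
`V`. The reflection `y ↦ -U(-y)` gives the mirror statements for a lower solution `W`
(`exists_lower`). Hence `U⁺ = V`, `U⁻ = W`, and the endpoints of the interval determine the case. -/

/-! ### Power series and the hypergeometric equation -/

theorem hasDerivAt_tsum_pow {b : ℕ → ℝ}
    (hb : ∀ r : ℝ, 0 < r → r < 1 → Summable fun n : ℕ => (n : ℝ) * |b n| * r ^ n)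
    {x : ℝ} (hx : |x| < 1) :
    HasDerivAt (fun x => ∑' n, b n * x ^ n) (∑' n : ℕ, b n * (n * x ^ (n - 1))) x := by
  obtain ⟨r, hxr, hr1⟩ := exists_between hx
  have hr0 : 0 < r := (abs_nonneg x).trans_lt hxr
  have hu : Summable fun n : ℕ => (n : ℝ) * |b n| * r ^ (n - 1) := by
    refine ((hb r hr0 hr1).mul_left r⁻¹).congr fun n => ?_
    cases n with
    | zero => simp
    | succ n => simp only [Nat.add_sub_cancel, pow_succ]; field_simp
  refine hasDerivAt_tsum_of_isPreconnected (t := Ioo (-r) r) (y₀ := 0) hu isOpen_Ioo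
    isPreconnected_Ioo (fun n y _ => (hasDerivAt_pow n y).const_mul (b n)) (fun n y hy => ?_)
    ⟨by linarith, hr0⟩ ?_ (abs_lt.1 hxr)
  · rw [Real.norm_eq_abs, abs_mul, abs_mul, abs_pow, Nat.abs_cast]
    have : |y| ≤ r := (abs_lt.2 hy).le
    calc |b n| * (n * |y| ^ (n - 1)) ≤ |b n| * (n * r ^ (n - 1)) := by gcongr
      _ = _ := by ring
  · refine summable_of_ne_finset_zero (s := {0}) fun n hn => ?_
    have : n ≠ 0 := by simpa using hn
    simp [this]

theorem tsum_pow_deriv_mul {b : ℕ → ℝ} (x : ℝ) :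
    x * ∑' n : ℕ, b n * (n * x ^ (n - 1)) = ∑' n : ℕ, (n * b n) * x ^ n := by
  rw [← tsum_mul_left]
  refine tsum_congr fun n => ?_
  cases n with
  | zero => simp
  | succ n => simp only [Nat.add_sub_cancel, pow_succ]; ring

/-- The ratio of consecutive coefficients of the hypergeometric series with parameters
`α + β = A + B + 1`, `α β = κ`, `γ = A + 1`. -/
def hgRatio (A B κ : ℝ) (n : ℕ) : ℝ :=
  ((n : ℝ) ^ 2 + (A + B + 1) * n + κ) / ((n + 1) * (n + 1 + A))

/-- The coefficients of this hypergeometric series. -/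
def hgCoeff (A B κ : ℝ) : ℕ → ℝ
  | 0 => 1
  | n + 1 => hgRatio A B κ n * hgCoeff A B κ n

theorem hgCoeff_nonneg {A B κ : ℝ} (hA : 0 ≤ A) (hB : 0 ≤ B) (hκ : 0 ≤ κ) (n : ℕ) :
    0 ≤ hgCoeff A B κ n := by
  induction n with
  | zero => simp [hgCoeff]
  | succ n ih => rw [hgCoeff]; exact mul_nonneg (by rw [hgRatio]; positivity) ih

theorem tendsto_hgRatio {A : ℝ} (hA : 0 ≤ A) (B κ : ℝ) :
    Tendsto (hgRatio A B κ) atTop (𝓝 1) := by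
  -- The ratio equals `1 + (κ - 1 - A + (B - 1)n)/(1 + A + n) · 1/(n + 1)`.
  have h := (((tendsto_add_mul_div_add_mul_atTop_nhds (κ - 1 - A) (1 + A) (B - 1)
    (one_ne_zero (α := ℝ))).mul (tendsto_one_div_add_atTop_nhds_zero_nat (𝕜 := ℝ))).const_add 1)
  simp only [mul_zero, add_zero] at h
  refine h.congr fun n => ?_
  have h1 : (n : ℝ) + 1 ≠ 0 := by positivity
  have h2 : (n : ℝ) + 1 + A ≠ 0 := by positivity
  have h3 : 1 + A + 1 * (n : ℝ) ≠ 0 := by positivity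
  rw [hgRatio]
  field_simp
  ring

/-- Ratio test. The powers `k = 0, 1, 2` serve `ψ`, `xψ'` and the derivative of `xψ'`. -/
theorem summable_pow_mul_hgCoeff {A B κ : ℝ} (hA : 0 ≤ A) (hB : 0 ≤ B) (hκ : 0 ≤ κ) (k : ℕ)
    {r : ℝ} (hr0 : 0 < r) (hr1 : r < 1) :
    Summable fun n : ℕ => (n : ℝ) ^ k * hgCoeff A B κ n * r ^ n := by
  obtain ⟨s, hrs, hs1⟩ := exists_between hr1
  have hlim : Tendsto (fun n : ℕ => ((1 + 1 * (n : ℝ)) / (0 + 1 * n)) ^ k * hgRatio A B κ n * r)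
      atTop (𝓝 r) := by
    simpa using (((tendsto_add_mul_div_add_mul_atTop_nhds (1 : ℝ) 0 1 one_ne_zero).pow k).mul
      (tendsto_hgRatio hA B κ)).mul_const r
  refine summable_of_ratio_norm_eventually_le hs1 ?_
  filter_upwards [hlim.eventually_le_const hrs, eventually_gt_atTop 0] with n hn hn0
  have hn' : (0 : ℝ) < n := by exact_mod_cast hn0
  have ha (m : ℕ) := hgCoeff_nonneg hA hB hκ m
  have hc (m : ℕ) : 0 ≤ (m : ℝ) ^ k * hgCoeff A B κ m * r ^ m :=
    mul_nonneg (mul_nonneg (by positivity) (ha m)) (by positivity)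
  rw [Real.norm_of_nonneg (hc _), Real.norm_of_nonneg (hc _)]
  refine le_trans (le_of_eq ?_) (mul_le_mul_of_nonneg_right hn (hc n))
  rw [hgCoeff, div_pow]
  push_cast
  field_simp
  ring

theorem hgCoeff_succ {A : ℝ} (hA : 0 ≤ A) (B κ : ℝ) (n : ℕ) :
    ((n : ℝ) + 1) * (n + 1 + A) * hgCoeff A B κ (n + 1) =
      ((n : ℝ) ^ 2 + (A + B + 1) * n + κ) * hgCoeff A B κ n := by
  have h1 : (n : ℝ) + 1 ≠ 0 := by positivity
  have h2 : (n : ℝ) + 1 + A ≠ 0 := by positivity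
  rw [hgCoeff, hgRatio]
  field_simp

/-- A solution `ψ` of the hypergeometric equation that is regular at `0`, together with
`θ = x ψ'`. -/
theorem exists_hypergeometric {A B κ : ℝ} (hA : 0 ≤ A) (hB : 0 ≤ B) (hκ : 0 ≤ κ) :
    ∃ ψ θ : ℝ → ℝ, Tendsto ψ (𝓝[>] 0) (𝓝 1) ∧ Tendsto θ (𝓝[>] 0) (𝓝 0) ∧
      ∀ x ∈ Ioo (0 : ℝ) 1, 1 ≤ ψ x ∧ HasDerivAt ψ (θ x / x) x ∧
        HasDerivAt θ ((x * ((A + B + 1) * θ x + κ * ψ x) - A * θ x) / (x * (1 - x))) x := by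
  set a := hgCoeff A B κ with ha
  have ha0 : ∀ n, 0 ≤ a n := hgCoeff_nonneg hA hB hκ
  have hsum (k : ℕ) {r : ℝ} (h0 : 0 < r) (h1 : r < 1) : Summable fun n : ℕ => n ^ k * a n * r ^ n :=
    summable_pow_mul_hgCoeff hA hB hκ k h0 h1
  have hd0 {x : ℝ} (hx : |x| < 1) := hasDerivAt_tsum_pow (b := a)
    (fun r h0 h1 => by simpa [abs_of_nonneg (ha0 _)] using hsum 1 h0 h1) hx
  have hd1 {x : ℝ} (hx : |x| < 1) := hasDerivAt_tsum_pow (b := fun n => n * a n)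
    (fun r h0 h1 => by
      refine (hsum 2 h0 h1).congr fun n => ?_
      rw [abs_of_nonneg (mul_nonneg n.cast_nonneg (ha0 n))]; ring) hx
  have hz0 : (∑' n, a n * (0 : ℝ) ^ n) = 1 := by
    rw [tsum_eq_single 0 (fun n hn => by simp [hn])]; simp [ha, hgCoeff]
  have hz1 : (∑' n, (n * a n) * (0 : ℝ) ^ n) = 0 := by
    rw [tsum_eq_single 0 (fun n hn => by simp [hn])]; simp
  refine ⟨fun x => ∑' n, a n * x ^ n, fun x => ∑' n, (n * a n) * x ^ n, ?_, ?_, ?_⟩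
  · have := (hd0 (x := 0) (by simp)).continuousAt.tendsto
    rw [hz0] at this
    exact this.mono_left nhdsWithin_le_nhds
  · have := (hd1 (x := 0) (by simp)).continuousAt.tendsto
    rw [hz1] at this
    exact this.mono_left nhdsWithin_le_nhds
  · rintro x ⟨hx0, hx1⟩
    have hx : |x| < 1 := by rwa [abs_of_pos hx0]
    have s0 : Summable fun n => a n * x ^ n := by simpa using hsum 0 hx0 hx1
    have s1 : Summable fun n : ℕ => n * a n * x ^ n := by simpa using hsum 1 hx0 hx1
    have s2 : Summable fun n : ℕ => n * (n * a n) * x ^ n :=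
      (hsum 2 hx0 hx1).congr fun n => by ring
    refine ⟨?_, ?_, ?_⟩
    · calc (1 : ℝ) = a 0 * x ^ 0 := by simp [ha, hgCoeff]
        _ ≤ _ := s0.le_tsum 0 fun n _ => mul_nonneg (ha0 n) (by positivity)
    · convert hd0 hx using 1
      simp only
      rw [← tsum_pow_deriv_mul, mul_div_cancel_left₀ _ hx0.ne']
    · convert hd1 hx using 1
      have e := tsum_pow_deriv_mul (b := fun n => n * a n) x
      rw [div_eq_iff (mul_ne_zero hx0.ne' (by linarith))]
      -- With `δ = x d/dx` this is `δ(δ + A)ψ = x(δ² + (A+B+1)δ + κ)ψ`. The left series has no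
      -- constant term; shifting its index by one matches the coefficient recursion.
      have key : (∑' n : ℕ, n * (n * a n) * x ^ n) + A * ∑' n : ℕ, n * a n * x ^ n =
          x * ((∑' n : ℕ, n * (n * a n) * x ^ n) + (A + B + 1) * (∑' n : ℕ, n * a n * x ^ n) +
            κ * ∑' n, a n * x ^ n) := by
        rw [← tsum_mul_left, ← s2.tsum_add (s1.mul_left A), ← tsum_mul_left, ← tsum_mul_left,
          ← s2.tsum_add (s1.mul_left _), ← (s2.add (s1.mul_left _)).tsum_add (s0.mul_left κ),
          ← tsum_mul_left, (s2.add (s1.mul_left A)).tsum_eq_zero_add]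
        simp only [Nat.cast_zero, zero_mul, mul_zero, add_zero, zero_add]
        refine tsum_congr fun n => ?_
        have := hgCoeff_succ hA B κ n
        rw [← ha] at this
        push_cast
        linear_combination x ^ (n + 1) * this
      simp only at e ⊢
      linear_combination -key - (1 - x) * e

/-! ### Normal form of the equation and the upper solution -/

/-- The slope `U'` prescribed by the equation at the point `y` and the value `u`. -/
def slope (ν : ℝ) (c : ℝ × ℝ × ℝ) (y u : ℝ) : ℝ :=
  (P c y - 2 * ν * y * u - (1 / 2) * u ^ 2) / (ν * (1 - y ^ 2))

theorem one_sub_sq_pos {y : ℝ} (hy : y ∈ Ioo (-1 : ℝ) 1) : 0 < 1 - y ^ 2 := by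
  nlinarith [mul_pos (sub_pos.2 hy.1) (sub_pos.2 hy.2)]

theorem isSolutionOn_iff {ν : ℝ} (hν : 0 < ν) {c : ℝ × ℝ × ℝ} {U : ℝ → ℝ} {a b : ℝ}
    (ha : -1 ≤ a) (hb : b ≤ 1) :
    IsSolutionOn ν c U a b ↔ ∀ y ∈ Ioo a b, HasDerivAt U (slope ν c y (U y)) y := by
  have hne : ∀ y ∈ Ioo a b, ν * (1 - y ^ 2) ≠ 0 := fun y hy =>
    (mul_pos hν (one_sub_sq_pos ⟨ha.trans_lt hy.1, hy.2.trans_le hb⟩)).ne'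
  constructor
  · rintro ⟨h1, h2⟩ y hy
    have hd := ((h1.differentiableOn one_ne_zero).differentiableAt (isOpen_Ioo.mem_nhds hy)).hasDerivAt
    have : deriv U y = slope ν c y (U y) := by
      rw [slope, eq_div_iff (hne y hy)]; linear_combination h2 y hy
    rwa [this] at hd
  · intro h
    have hc : ContinuousOn U (Ioo a b) := fun y hy => (h y hy).continuousAt.continuousWithinAt
    refine ⟨?_, fun y hy => ?_⟩
    · rw [show (1 : WithTop ℕ∞) = 0 + 1 by simp, contDiffOn_succ_iff_deriv_of_isOpen isOpen_Ioo]
      refine ⟨fun y hy => (h y hy).differentiableAt.differentiableWithinAt, by simp, ?_⟩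
      rw [contDiffOn_zero]
      refine ContinuousOn.congr (f := fun y => slope ν c y (U y)) ?_ fun y hy => (h y hy).deriv
      unfold slope P
      exact ContinuousOn.div (by fun_prop) (by fun_prop) hne
    · rw [(h y hy).deriv, slope]
      have e (N D : ℝ) (hD : D ≠ 0) : D * (N / D) = N := by field_simp
      rw [e _ _ (hne y hy)]
      ring

/-- A global solution `V` with the boundary value `τ₂` at `-1`, an integrating factor `G` of the
linearization of the equation at `V`, and an antiderivative `F` of the reciprocal of
`2 ν (1 - y²) G`. -/
structure IsUpper (ν : ℝ) (c : ℝ × ℝ × ℝ) (V G F : ℝ → ℝ) : Prop where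
  sol : ∀ y ∈ Ioo (-1 : ℝ) 1, HasDerivAt V (slope ν c y (V y)) y
  pos : ∀ y ∈ Ioo (-1 : ℝ) 1, 0 < G y
  hasDerivAt_factor :
    ∀ y ∈ Ioo (-1 : ℝ) 1, HasDerivAt G (G y * (2 * ν * y + V y) / (ν * (1 - y ^ 2))) y
  hasDerivAt_anti : ∀ y ∈ Ioo (-1 : ℝ) 1, HasDerivAt F (1 / (2 * ν * (1 - y ^ 2) * G y)) y
  tendsto_anti : Tendsto F (𝓝[>] (-1)) atBot
  tendsto_sol : Tendsto V (𝓝[>] (-1)) (𝓝 (tau2 ν c))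

theorem exists_antideriv {f : ℝ → ℝ} {a b s : ℝ} (hs : s ∈ Ioo a b) (hf : ContinuousOn f (Ioo a b)) :
    ∃ F : ℝ → ℝ, ∀ y ∈ Ioo a b, HasDerivAt F (f y) y := by
  refine ⟨fun y => ∫ t in s..y, f t, fun y hy => ?_⟩
  have hsub : uIcc s y ⊆ Ioo a b := (convex_Ioo a b).ordConnected.uIcc_subset hs hy
  exact intervalIntegral.integral_hasDerivAt_right (hf.mono hsub).intervalIntegrable
    (hf.stronglyMeasurableAtFilter isOpen_Ioo y hy) (hf.continuousAt (isOpen_Ioo.mem_nhds hy))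

/-- An antiderivative of the reciprocal of `(1 - y²) G` with `G` positive and bounded near `-1`
tends to `-∞` at `-1`. -/
theorem tendsto_antideriv_atBot {ν S b : ℝ} (hν : 0 < ν) (hS : 0 < S) (hb : b ∈ Ioo (-1 : ℝ) 1)
    {F G : ℝ → ℝ} (hF : ∀ y ∈ Ioo (-1 : ℝ) 1, HasDerivAt F (1 / (2 * ν * (1 - y ^ 2) * G y)) y)
    (hG : ∀ y ∈ Ioo (-1 : ℝ) 1, 0 < G y) (hGS : ∀ y ∈ Ioo (-1 : ℝ) b, G y ≤ S) :
    Tendsto F (𝓝[>] (-1)) atBot := by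
  -- From `1 - y² ≤ 2(1 + y)` and `G ≤ S` follows `F' ≥ k/(1 + y)`, so `F - k log(1 + y)` is
  -- monotone near `-1`.
  set k := 1 / (4 * ν * S) with hk
  have hk0 : 0 < k := by positivity
  have hd : ∀ y ∈ Ioo (-1 : ℝ) 1, HasDerivAt (fun y => F y - k * Real.log (1 + y))
      (1 / (2 * ν * (1 - y ^ 2) * G y) - k * (1 / (1 + y))) y := fun y hy =>
    (hF y hy).sub ((((hasDerivAt_id y).const_add 1).log (by simp; linarith [hy.1])).const_mul k)
  have hmono : MonotoneOn (fun y => F y - k * Real.log (1 + y)) (Ioc (-1) b) := by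
    refine monotoneOn_of_deriv_nonneg (convex_Ioc _ _) (fun y hy =>
      (hd y ⟨hy.1, hy.2.trans_lt hb.2⟩).continuousAt.continuousWithinAt) (fun y hy => ?_)
      fun y hy => ?_ <;> rw [interior_Ioc] at hy
    · exact (hd y ⟨hy.1, hy.2.trans hb.2⟩).differentiableAt.differentiableWithinAt
    · have hy' : y ∈ Ioo (-1 : ℝ) 1 := ⟨hy.1, hy.2.trans hb.2⟩
      rw [(hd y hy').deriv, sub_nonneg, hk, div_mul_div_comm, mul_one]
      have h1 : 0 < 1 + y := by linarith [hy.1]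
      have h2 := one_sub_sq_pos hy'
      have h3 := hG y hy'
      have h4 : 1 - y ^ 2 ≤ 2 * (1 + y) := by nlinarith [hy'.2]
      refine one_div_le_one_div_of_le (by positivity) ?_
      calc 2 * ν * (1 - y ^ 2) * G y ≤ 2 * ν * (2 * (1 + y)) * S :=
            mul_le_mul (by gcongr) (hGS y hy) h3.le (by positivity)
        _ = _ := by ring
  have hlog : Tendsto (fun y : ℝ => k * Real.log (1 + y) + (F b - k * Real.log (1 + b)))
      (𝓝[>] (-1)) atBot := by
    refine tendsto_atBot_add_const_right _ _ ((Real.tendsto_log_nhdsGT_zero.comp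
      (tendsto_nhdsWithin_iff.2 ⟨?_, ?_⟩)).const_mul_atBot hk0)
    · have : ContinuousAt (fun y : ℝ => 1 + y) (-1) := by fun_prop
      simpa using this.tendsto.mono_left nhdsWithin_le_nhds
    · filter_upwards [self_mem_nhdsWithin] with y hy
      have : -1 < y := hy
      simp; linarith
  refine tendsto_atBot_mono' _ ?_ hlog
  filter_upwards [Ioo_mem_nhdsGT hb.1] with y hy
  have := hmono ⟨hy.1, hy.2.le⟩ ⟨hb.1, le_rfl⟩ hy.2.le
  simp only at this
  linarith

/-- Linearization of the Riccati equation; membership in `J ν` is what makes `A`, `B` real and `κ ≥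
0`. -/
theorem exists_isUpper {ν : ℝ} (hν : 0 < ν) {c : ℝ × ℝ × ℝ} (hc : c ∈ J ν) :
    ∃ V G F : ℝ → ℝ, IsUpper ν c V G F := by
  obtain ⟨c1, c2, c3⟩ := c
  obtain ⟨h1, h2, h3⟩ := hc
  simp only at h1 h2 h3
  set A := √(ν ^ 2 + c1) / ν with hA
  set B := √(ν ^ 2 + c2) / ν with hB
  set κ := (c3 - c3bar ν c1 c2) / (2 * ν ^ 2) with hκ
  have hA0 : 0 ≤ A := by positivity
  have hB0 : 0 ≤ B := by positivity
  have hκ0 : 0 ≤ κ := div_nonneg (by linarith) (by positivity)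
  have hAs : √(ν ^ 2 + c1) = ν * A := by rw [hA]; field_simp
  have hBs : √(ν ^ 2 + c2) = ν * B := by rw [hB]; field_simp
  have e1 : c1 = ν ^ 2 * (A ^ 2 - 1) := by
    have := Real.sq_sqrt (show 0 ≤ ν ^ 2 + c1 by linarith)
    rw [hAs] at this; linear_combination -this
  have e2 : c2 = ν ^ 2 * (B ^ 2 - 1) := by
    have := Real.sq_sqrt (show 0 ≤ ν ^ 2 + c2 by linarith)
    rw [hBs] at this; linear_combination -this
  have e3 : c3 = -(1 / 2) * ν ^ 2 * (A + B) * (A + B + 2) + 2 * ν ^ 2 * κ := by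
    have : κ * (2 * ν ^ 2) = c3 - c3bar ν c1 c2 := by rw [hκ]; field_simp
    rw [c3bar, hAs, hBs] at this
    linear_combination -this
  obtain ⟨ψ, θ, hψ0, hθ0, hx⟩ := exists_hypergeometric hA0 hB0 hκ0
  have hxmem {y : ℝ} (hy : y ∈ Ioo (-1 : ℝ) 1) : (1 + y) / 2 ∈ Ioo (0 : ℝ) 1 :=
    ⟨by linarith [hy.1], by linarith [hy.2]⟩
  have dx (y : ℝ) : HasDerivAt (fun y : ℝ => (1 + y) / 2) (1 / 2) y :=
    ((hasDerivAt_id y).const_add 1).div_const 2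
  have dψ {y : ℝ} (hy : y ∈ Ioo (-1 : ℝ) 1) :=
    HasDerivAt.comp y (hx _ (hxmem hy)).2.1 (dx y)
  have dθ {y : ℝ} (hy : y ∈ Ioo (-1 : ℝ) 1) :=
    HasDerivAt.comp y (hx _ (hxmem hy)).2.2 (dx y)
  -- This is `2ν(1 - y²) w'/w`; the factors `(1 ± y)^(1/2)` of `w` contribute the term `-y`. Below,
  -- `G = w²/(1 - y²)`.
  set V : ℝ → ℝ := fun y => 2 * ν * (A * (1 - (1 + y) / 2) - B * ((1 + y) / 2) +
    2 * (1 - (1 + y) / 2) * ((θ ∘ fun y => (1 + y) / 2) y) / ((ψ ∘ fun y => (1 + y) / 2) y) - y) with hV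
  set G : ℝ → ℝ := fun y => Real.exp (A * Real.log (1 + y) + B * Real.log (1 - y)) *
    ((ψ ∘ fun y => (1 + y) / 2) y) ^ 2 with hG
  have hGpos : ∀ y ∈ Ioo (-1 : ℝ) 1, 0 < G y := fun y hy =>
    mul_pos (Real.exp_pos _) (pow_pos (one_pos.trans_le (hx _ (hxmem hy)).1) 2)
  have hGd : ∀ y ∈ Ioo (-1 : ℝ) 1,
      HasDerivAt G (G y * (2 * ν * y + V y) / (ν * (1 - y ^ 2))) y := by
    intro y hy
    have hp : (1 + y) ≠ 0 := by linarith [hy.1]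
    have hm : (1 - y) ≠ 0 := by linarith [hy.2]
    have hψ : ψ ((1 + y) / 2) ≠ 0 := (one_pos.trans_le (hx _ (hxmem hy)).1).ne'
    have d1 := (((hasDerivAt_id y).const_add 1).log hp).const_mul A
    have d2 := (((hasDerivAt_id y).const_sub 1).log hm).const_mul B
    have := ((d1.add d2).exp).mul ((dψ hy).pow 2)
    refine this.congr_deriv ?_
    have h5 : 1 - y ^ 2 = (1 + y) * (1 - y) := by ring
    simp only [hV, hG, Function.comp, id, Pi.add_apply, Pi.pow_apply, h5]
    generalize Real.exp _ = E
    generalize θ _ = t at *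
    generalize ψ _ = p at *
    field_simp
    ring
  have hGc : ContinuousOn (fun y => 1 / (2 * ν * (1 - y ^ 2) * G y)) (Ioo (-1) 1) := by
    have : ContinuousOn G (Ioo (-1) 1) := fun y hy => (hGd y hy).continuousAt.continuousWithinAt
    refine ContinuousOn.div (by fun_prop) (by fun_prop) fun y hy => ?_
    have := one_sub_sq_pos hy
    have := hGpos y hy
    positivity
  obtain ⟨F, hF⟩ := exists_antideriv (s := 0) (by simp) hGc
  have hxlim : Tendsto (fun y : ℝ => (1 + y) / 2) (𝓝[>] (-1)) (𝓝[>] 0) := by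
    refine tendsto_nhdsWithin_iff.2 ⟨?_, ?_⟩
    · simpa using (dx (-1)).continuousAt.tendsto.mono_left nhdsWithin_le_nhds
    · filter_upwards [self_mem_nhdsWithin] with y hy
      have : -1 < y := hy
      simp; linarith
  have hψl := hψ0.comp hxlim
  have hθl := hθ0.comp hxlim
  refine ⟨V, G, F, fun y hy => ?_, hGpos, hGd, hF, ?_, ?_⟩
  · have hp : (1 + y) ≠ 0 := by linarith [hy.1]
    have hm : (1 - y) ≠ 0 := by linarith [hy.2]
    have hψ : ψ ((1 + y) / 2) ≠ 0 := (one_pos.trans_le (hx _ (hxmem hy)).1).ne'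
    have := (((((dx y).const_sub 1).const_mul A).sub ((dx y).const_mul B)).add
      (((((dx y).const_sub 1).const_mul 2).mul (dθ hy)).div (dψ hy) hψ)).sub (hasDerivAt_id y)
    refine (this.const_mul (2 * ν)).congr_deriv ?_
    simp only [slope, P, hV, e3, Function.comp, Pi.mul_apply]
    rw [e1, e2]
    obtain ⟨x, rfl⟩ : ∃ x, y = 2 * x - 1 := ⟨(1 + y) / 2, by ring⟩
    have h6 : (1 + (2 * x - 1)) / 2 = x := by ring
    have hx0 : x ≠ 0 := by rintro rfl; simp at hp
    have hx1 : 1 - x ≠ 0 := by intro h; apply hm; linear_combination 2 * h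
    simp only [h6] at *
    have h7 : 1 - (2 * x - 1) ^ 2 = 4 * x * (1 - x) := by ring
    rw [h7]
    generalize θ _ = t at *
    generalize ψ _ = p at *
    field_simp
    ring
  · obtain ⟨b, hb, hb'⟩ := mem_nhdsGT_iff_exists_Ioo_subset.1
      ((hψl.eventually_lt_const one_lt_two).and (Ioo_mem_nhdsGT (show (-1 : ℝ) < 0 by norm_num)))
    have hb1 : min b 0 ∈ Ioo (-1 : ℝ) 1 := ⟨lt_min hb (by norm_num), by simp⟩
    -- For `-1 < y < min b 0`: `(1+y)^A ≤ 1`, `(1-y)^B ≤ 2^B` and `ψ < 2`.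
    refine tendsto_antideriv_atBot (S := Real.exp (B * Real.log 2) * 2 ^ 2) hν (by positivity) hb1
      hF hGpos fun y hy => ?_
    have hy1 : y < 0 := hy.2.trans_le (min_le_right _ _)
    have hy2 := (hb' ⟨hy.1, hy.2.trans_le (min_le_left _ _)⟩).1
    have hy3 := (hx _ (hxmem ⟨hy.1, hy1.trans one_pos⟩)).1
    have l1 : Real.log (1 + y) ≤ 0 := Real.log_nonpos (by linarith [hy.1]) (by linarith)
    have l2 : Real.log (1 - y) ≤ Real.log 2 :=
      Real.log_le_log (by linarith) (by linarith [hy.1])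
    refine mul_le_mul (Real.exp_le_exp.2 ?_) ?_ (by positivity) (by positivity)
    · nlinarith [mul_nonneg hA0 (neg_nonneg.2 l1), mul_le_mul_of_nonneg_left l2 hB0]
    · exact pow_le_pow_left₀ (by simp only [Function.comp]; linarith) hy2.le 2
  · have hyl : Tendsto (fun y : ℝ => y) (𝓝[>] (-1)) (𝓝 (-1)) := nhdsWithin_le_nhds
    have hxl := hxlim.mono_right nhdsWithin_le_nhds
    have := (((((hxl.const_sub 1).const_mul A).sub (hxl.const_mul B)).add
      ((((hxl.const_sub 1).const_mul 2).mul hθl).div hψl one_ne_zero)).sub hyl).const_mul (2 * ν)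
    refine (this.congr fun y => by simp [hV]).trans_eq ?_
    simp only [tau2, hAs]
    ring_nf

/-! ### Linear equations and L'Hôpital's rule -/

theorem constant_on_Ioo {f : ℝ → ℝ} {a b : ℝ} (hf : ∀ y ∈ Ioo a b, HasDerivAt f 0 y) {s y : ℝ}
    (hs : s ∈ Ioo a b) (hy : y ∈ Ioo a b) : f y = f s :=
  isOpen_Ioo.is_const_of_deriv_eq_zero isPreconnected_Ioo
    (fun x hx => (hf x hx).differentiableAt.differentiableWithinAt) (fun x hx => (hf x hx).deriv)
    hy hs

/-- A solution of a homogeneous linear equation vanishes everywhere or nowhere. -/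
theorem eq_zero_of_linear {f h : ℝ → ℝ} {a b : ℝ} (hf : ∀ y ∈ Ioo a b, HasDerivAt f (h y * f y) y)
    (hh : ContinuousOn h (Ioo a b)) {s y : ℝ} (hs : s ∈ Ioo a b) (hy : y ∈ Ioo a b)
    (h0 : f s = 0) : f y = 0 := by
  obtain ⟨H, hH⟩ := exists_antideriv hs hh
  have := constant_on_Ioo (f := fun y => f y * Real.exp (-H y)) (fun x hx =>
    ((hf x hx).mul (hH x hx).neg.exp).congr_deriv (by ring)) hs hy
  simpa [h0, (Real.exp_pos _).ne'] using this

/-- L'Hôpital's rule at the left end of an interval, for a denominator tending to `-∞`. -/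
theorem tendsto_div_of_deriv_of_atBot {f g f' g' : ℝ → ℝ} {a b L : ℝ} (hab : a < b)
    (hf : ∀ y ∈ Ioo a b, HasDerivAt f (f' y) y) (hg : ∀ y ∈ Ioo a b, HasDerivAt g (g' y) y)
    (hg' : ∀ y ∈ Ioo a b, 0 < g' y) (hlim : Tendsto g (𝓝[>] a) atBot)
    (hL : Tendsto (fun y => f' y / g' y) (𝓝[>] a) (𝓝 L)) :
    Tendsto (fun y => f y / g y) (𝓝[>] a) (𝓝 L) := by
  have hinv (C : ℝ) : Tendsto (fun y => C / g y) (𝓝[>] a) (𝓝 0) := hlim.const_div_atBot C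
  have sub_nonneg_mono {h h' : ℝ → ℝ} {d : ℝ} (hd : d ∈ Ioo a b)
      (hh : ∀ y ∈ Ioo a b, HasDerivAt h (h' y) y) (hp : ∀ y ∈ Ioo a d, 0 ≤ h' y) {y : ℝ}
      (hy : y ∈ Ioo a d) : h y ≤ h d := by
    refine monotoneOn_of_deriv_nonneg (convex_Ioc a d) (fun y hy =>
      (hh y ⟨hy.1, hy.2.trans_lt hd.2⟩).continuousAt.continuousWithinAt) (fun y hy => ?_)
      (fun y hy => ?_) ⟨hy.1, hy.2.le⟩ ⟨hd.1, le_rfl⟩ hy.2.le <;> rw [interior_Ioc] at hy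
    · exact (hh y ⟨hy.1, hy.2.trans hd.2⟩).differentiableAt.differentiableWithinAt
    · rw [(hh y ⟨hy.1, hy.2.trans hd.2⟩).deriv]; exact hp y hy
  rw [tendsto_order]
  constructor
  · intro l hl
    -- Near `a` the function `f - m g` is monotone, hence bounded above by its value at `e`; this
    -- constant is negligible against `(l - m) g → +∞`. No limit of `f` is needed.
    obtain ⟨m, hlm, hmL⟩ := exists_between hl
    obtain ⟨d, hd, hd'⟩ := mem_nhdsGT_iff_exists_mem_Ioc_Ioo_subset hab |>.1
      (hL.eventually_const_lt hmL)
    obtain ⟨e, hae, hed⟩ := exists_between hd.1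
    have he : e ∈ Ioo a b := ⟨hae, hed.trans_le hd.2⟩
    have hm := fun y (hy : y ∈ Ioo a e) => sub_nonneg_mono (h := fun y => f y - m * g y)
      (h' := fun y => f' y - m * g' y) he (fun y hy => (hf y hy).sub ((hg y hy).const_mul m))
      (fun y hy => by
        have h1 : m < f' y / g' y := hd' ⟨hy.1, hy.2.trans hed⟩
        rw [lt_div_iff₀ (hg' y ⟨hy.1, hy.2.trans he.2⟩)] at h1
        linarith) hy
    have hC := (hinv (f e - m * g e)).eventually_const_lt (sub_neg.2 hlm)
    filter_upwards [Ioo_mem_nhdsGT hae, hC, hlim.eventually_lt_atBot 0] with y hy hCy hgy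
    have h1 : f e - m * g e < (l - m) * g y := by rwa [lt_div_iff_of_neg hgy] at hCy
    rw [lt_div_iff_of_neg hgy]
    have := hm y hy
    linarith
  · intro l hl
    obtain ⟨m, hLm, hml⟩ := exists_between hl
    obtain ⟨d, hd, hd'⟩ := mem_nhdsGT_iff_exists_mem_Ioc_Ioo_subset hab |>.1
      (hL.eventually_lt_const hLm)
    obtain ⟨e, hae, hed⟩ := exists_between hd.1
    have he : e ∈ Ioo a b := ⟨hae, hed.trans_le hd.2⟩
    have hm := fun y (hy : y ∈ Ioo a e) => sub_nonneg_mono (h := fun y => m * g y - f y)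
      (h' := fun y => m * g' y - f' y) he (fun y hy => ((hg y hy).const_mul m).sub (hf y hy))
      (fun y hy => by
        have h1 : f' y / g' y < m := hd' ⟨hy.1, hy.2.trans hed⟩
        rw [div_lt_iff₀ (hg' y ⟨hy.1, hy.2.trans he.2⟩)] at h1
        linarith) hy
    have hC := (hinv (f e - m * g e)).eventually_lt_const (sub_pos.2 hml)
    filter_upwards [Ioo_mem_nhdsGT hae, hC, hlim.eventually_lt_atBot 0] with y hy hCy hgy
    have h1 : (l - m) * g y < f e - m * g e := by rwa [div_lt_iff_of_neg hgy] at hCy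
    rw [div_lt_iff_of_neg hgy]
    have := hm y hy
    linarith

/-! ### All solutions in terms of the upper one -/

namespace IsUpper

variable {ν : ℝ} {c : ℝ × ℝ × ℝ} {V G F : ℝ → ℝ}

theorem anti_deriv_pos (H : IsUpper ν c V G F) (hν : 0 < ν) {y : ℝ} (hy : y ∈ Ioo (-1 : ℝ) 1) :
    0 < 1 / (2 * ν * (1 - y ^ 2) * G y) := by
  have := one_sub_sq_pos hy
  have := H.pos y hy
  positivity

theorem continuousOn_factor (H : IsUpper ν c V G F) : ContinuousOn G (Ioo (-1) 1) :=
  fun y hy => (H.hasDerivAt_factor y hy).continuousAt.continuousWithinAt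

theorem continuousOn_anti (H : IsUpper ν c V G F) : ContinuousOn F (Ioo (-1) 1) :=
  fun y hy => (H.hasDerivAt_anti y hy).continuousAt.continuousWithinAt

theorem strictMonoOn_anti (H : IsUpper ν c V G F) (hν : 0 < ν) : StrictMonoOn F (Ioo (-1) 1) := by
  refine strictMonoOn_of_deriv_pos (convex_Ioo _ _) H.continuousOn_anti fun y hy => ?_
  rw [interior_Ioo] at hy
  rw [(H.hasDerivAt_anti y hy).deriv]
  exact H.anti_deriv_pos hν hy

/-- The solutions of the equation other than `V`. -/
theorem hasDerivAt_add (H : IsUpper ν c V G F) (hν : 0 < ν) {K y : ℝ} (hy : y ∈ Ioo (-1 : ℝ) 1)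
    (hK : F y + K ≠ 0) :
    HasDerivAt (fun y => V y + 1 / (G y * (F y + K)))
      (slope ν c y (V y + 1 / (G y * (F y + K)))) y := by
  have hG := (H.pos y hy).ne'
  have h1 := (one_sub_sq_pos hy).ne'
  have hd := ((H.hasDerivAt_factor y hy).mul ((H.hasDerivAt_anti y hy).add_const K))
  refine ((H.sol y hy).add ((hasDerivAt_const y (1 : ℝ)).div hd (mul_ne_zero hG hK))).congr_deriv ?_
  simp only [slope, Pi.mul_apply]
  generalize 1 - y ^ 2 = q at *
  generalize F y + K = k at *
  field_simp
  ring

/-- The weighted difference `ζ = (U - V) G` satisfies `ζ' = -F' ζ²`. Read as a linear equation, this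
shows that `ζ` vanishes everywhere or nowhere; in the latter case `1/ζ - F` is the constant `K`. -/
theorem eqOn_or_exists (H : IsUpper ν c V G F) (hν : 0 < ν) {U : ℝ → ℝ} {a b : ℝ} (hab : a < b)
    (ha : -1 ≤ a) (hb : b ≤ 1) (hU : IsSolutionOn ν c U a b) :
    EqOn U V (Ioo a b) ∨
      ∃ K, ∀ y ∈ Ioo a b, F y + K ≠ 0 ∧ U y = V y + 1 / (G y * (F y + K)) := by
  rw [isSolutionOn_iff hν ha hb] at hU
  have hI : Ioo a b ⊆ Ioo (-1) 1 := Ioo_subset_Ioo ha hb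
  obtain ⟨s, hs⟩ := nonempty_Ioo.2 hab
  set ζ : ℝ → ℝ := fun y => (U y - V y) * G y with hζ
  have hd : ∀ y ∈ Ioo a b, HasDerivAt ζ (-(ζ y) * (1 / (2 * ν * (1 - y ^ 2) * G y)) * ζ y) y := by
    intro y hy
    have hG := (H.pos y (hI hy)).ne'
    have h1 := (one_sub_sq_pos (hI hy)).ne'
    refine (((hU y hy).sub (H.sol y (hI hy))).mul (H.hasDerivAt_factor y (hI hy))).congr_deriv ?_
    simp only [slope, hζ, Pi.sub_apply]
    generalize 1 - y ^ 2 = q at *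
    field_simp
    ring
  have hc : ContinuousOn (fun y => -(ζ y) * (1 / (2 * ν * (1 - y ^ 2) * G y))) (Ioo a b) := by
    have h1 : ContinuousOn ζ (Ioo a b) := fun y hy => (hd y hy).continuousAt.continuousWithinAt
    have h2 := H.continuousOn_factor.mono hI
    refine h1.neg.mul (ContinuousOn.div (by fun_prop) (by fun_prop) fun y hy => ?_)
    have := one_sub_sq_pos (hI hy)
    have := H.pos y (hI hy)
    positivity
  by_cases hs0 : ζ s = 0
  · left
    intro y hy
    have := eq_zero_of_linear hd hc hs hy hs0
    simpa [hζ, (H.pos y (hI hy)).ne', sub_eq_zero] using this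
  · right
    have hne : ∀ y ∈ Ioo a b, ζ y ≠ 0 := fun y hy h => hs0 (eq_zero_of_linear hd hc hy hs h)
    have hconst := fun y (hy : y ∈ Ioo a b) =>
      constant_on_Ioo (f := fun y => (ζ y)⁻¹ - F y) (fun x hx => by
        have hx0 := hne x hx
        refine (((hd x hx).inv hx0).sub (H.hasDerivAt_anti x (hI hx))).congr_deriv ?_
        field_simp
        ring) hs hy
    refine ⟨(ζ s)⁻¹ - F s, fun y hy => ?_⟩
    have h1 : F y + ((ζ s)⁻¹ - F s) = (ζ y)⁻¹ := by rw [← hconst y hy]; ring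
    have hG := (H.pos y (hI hy)).ne'
    rw [h1]
    refine ⟨inv_ne_zero (hne y hy), ?_⟩
    have h2 : U y - V y ≠ 0 := fun h => hne y hy (by simp [hζ, h])
    simp only [hζ]
    field_simp
    ring

theorem eqOn_of_eq (H : IsUpper ν c V G F) (hν : 0 < ν) {U W : ℝ → ℝ} {a b s : ℝ}
    (hs : s ∈ Ioo a b) (ha : -1 ≤ a) (hb : b ≤ 1) (hU : IsSolutionOn ν c U a b)
    (hW : IsSolutionOn ν c W a b) (h : U s = W s) : EqOn U W (Ioo a b) := by
  have hab := hs.1.trans hs.2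
  have hG := (H.pos s ⟨ha.trans_lt hs.1, hs.2.trans_le hb⟩).ne'
  rcases H.eqOn_or_exists hν hab ha hb hU with hU' | ⟨K, hK⟩ <;>
    rcases H.eqOn_or_exists hν hab ha hb hW with hW' | ⟨M, hM⟩
  · exact hU'.trans hW'.symm
  · have h1 := hM s hs
    have h2 : 1 / (G s * (F s + M)) ≠ 0 := one_div_ne_zero (mul_ne_zero hG h1.1)
    exact absurd (by linarith [hU' hs]) h2
  · have h1 := hK s hs
    have h2 : 1 / (G s * (F s + K)) ≠ 0 := one_div_ne_zero (mul_ne_zero hG h1.1)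
    exact absurd (by linarith [hW' hs]) h2
  · have h1 := hK s hs
    have h2 := hM s hs
    have h3 : 1 / (G s * (F s + K)) = 1 / (G s * (F s + M)) := by linarith
    have h4 : K = M := by
      rw [one_div, one_div, inv_inj] at h3
      linarith [mul_left_cancel₀ hG h3]
    intro y hy
    rw [(hK y hy).2, (hM y hy).2, h4]

/-- L'Hôpital's rule for `G⁻¹` over `F + K`: the quotient of derivatives is `-2(2νy + V)`, with
limit `-4√(ν² + c₁) = τ₁ - τ₂`. -/
theorem tendsto_add (H : IsUpper ν c V G F) (hν : 0 < ν) (K : ℝ) :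
    Tendsto (fun y => V y + 1 / (G y * (F y + K))) (𝓝[>] (-1)) (𝓝 (tau1 ν c)) := by
  have hy1 : Ioo (-1 : ℝ) 1 ∈ 𝓝[>] (-1 : ℝ) := Ioo_mem_nhdsGT (by norm_num)
  have hyl : Tendsto (fun y : ℝ => y) (𝓝[>] (-1)) (𝓝 (-1)) := nhdsWithin_le_nhds
  have hL : Tendsto (fun y => -2 * (2 * ν * y + V y)) (𝓝[>] (-1))
      (𝓝 (-2 * (2 * ν * (-1) + tau2 ν c))) :=
    ((hyl.const_mul (2 * ν)).add H.tendsto_sol).const_mul (-2)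
  have := tendsto_div_of_deriv_of_atBot (f := fun y => (G y)⁻¹) (g := fun y => F y + K)
    (show (-1 : ℝ) < 1 by norm_num) (fun y hy => (H.hasDerivAt_factor y hy).inv (H.pos y hy).ne')
    (fun y hy => (H.hasDerivAt_anti y hy).add_const K) (fun y hy => H.anti_deriv_pos hν hy)
    (tendsto_atBot_add_const_right _ K H.tendsto_anti) (hL.congr' ?_)
  · refine ((H.tendsto_sol.add this).congr fun y => ?_).trans_eq ?_
    · rw [one_div, mul_inv, div_eq_mul_inv]
    · simp only [tau1, tau2]
      ring_nf
  · filter_upwards [hy1] with y hy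
    have hG := (H.pos y hy).ne'
    have h1 := (one_sub_sq_pos hy).ne'
    generalize 1 - y ^ 2 = q at *
    field_simp

/-- `F + K` is negative near `-1` and cannot change sign without a zero. -/
theorem anti_add_neg (H : IsUpper ν c V G F) {K b : ℝ} (hb : b ≤ 1)
    (hK : ∀ y ∈ Ioo (-1) b, F y + K ≠ 0) : ∀ y ∈ Ioo (-1) b, F y + K < 0 := by
  intro y hy
  by_contra! h
  have hmem : ∀ᶠ x in 𝓝[>] (-1 : ℝ), x ∈ Ioo (-1) y := Ioo_mem_nhdsGT hy.1
  obtain ⟨x, hx, hxF⟩ := (hmem.and (H.tendsto_anti.eventually_lt_atBot (-K))).exists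
  obtain ⟨t, ht, htF⟩ := intermediate_value_Icc hx.2.le
    (H.continuousOn_anti.mono fun t ht => ⟨hx.1.trans_le ht.1, ht.2.trans_lt (hy.2.trans_le hb)⟩)
    ⟨hxF.le, by linarith⟩
  exact hK t ⟨hx.1.trans_le ht.1, ht.2.trans_lt hy.2⟩ (by linarith)

theorem isSolutionOn (H : IsUpper ν c V G F) (hν : 0 < ν) : IsSolutionOn ν c V (-1) 1 :=
  (isSolutionOn_iff hν le_rfl le_rfl).2 H.sol

theorem isSolutionOn_add (H : IsUpper ν c V G F) (hν : 0 < ν) {K a b : ℝ} (ha : -1 ≤ a) (hb : b ≤ 1)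
    (hK : ∀ y ∈ Ioo a b, F y + K ≠ 0) :
    IsSolutionOn ν c (fun y => V y + 1 / (G y * (F y + K))) a b :=
  (isSolutionOn_iff hν ha hb).2 fun y hy =>
    H.hasDerivAt_add hν ⟨ha.trans_lt hy.1, hy.2.trans_le hb⟩ (hK y hy)

theorem eqOn_or_lt (H : IsUpper ν c V G F) (hν : 0 < ν) {U : ℝ → ℝ} {b : ℝ} (hb0 : -1 < b)
    (hb : b ≤ 1) (hU : IsSolutionOn ν c U (-1) b) :
    EqOn U V (Ioo (-1) b) ∨
      (∀ y ∈ Ioo (-1) b, U y < V y) ∧ Tendsto U (𝓝[>] (-1)) (𝓝 (tau1 ν c)) := by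
  refine (H.eqOn_or_exists hν hb0 le_rfl hb hU).imp_right ?_
  rintro ⟨K, hK⟩
  have hneg := H.anti_add_neg hb fun y hy => (hK y hy).1
  refine ⟨fun y hy => ?_, (H.tendsto_add hν K).congr' ?_⟩
  · have := mul_neg_of_pos_of_neg (H.pos y ⟨hy.1, hy.2.trans_le hb⟩) (hneg y hy)
    rw [(hK y hy).2]
    linarith [one_div_neg.2 this]
  · filter_upwards [Ioo_mem_nhdsGT hb0] with y hy using (hK y hy).2.symm

/-- The formula `V + 1/(G(F+K))` solves the equation wherever `F + K ≠ 0`, so maximality pins `y₀`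
to the zero of `F + K`. -/
theorem right_of_maximal (H : IsUpper ν c V G F) (hν : 0 < ν) {U : ℝ → ℝ} {y₀ y₁ : ℝ}
    (hU : IsMaximalSolution ν c U y₀ y₁) (hy₀ : -1 < y₀) :
    y₁ = 1 ∧ (∀ y ∈ Ioo y₀ y₁, V y < U y) ∧ Tendsto U (𝓝[>] y₀) atTop := by
  obtain ⟨-, h01, h1, hsol, hmax⟩ := hU
  have hI : Ioo y₀ y₁ ⊆ Ioo (-1) 1 := Ioo_subset_Ioo hy₀.le h1
  have hmono := H.strictMonoOn_anti hν
  rcases H.eqOn_or_exists hν h01 hy₀.le h1 hsol with hUV | ⟨K, hK⟩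
  · exact absurd (hmax (-1) 1 V le_rfl hy₀.le h1 le_rfl (H.isSolutionOn hν) hUV.symm).1 hy₀.ne
  have heq : EqOn (fun y => V y + 1 / (G y * (F y + K))) U (Ioo y₀ y₁) :=
    fun y hy => (hK y hy).2.symm
  have hy₀' : y₀ ∈ Ioo (-1 : ℝ) 1 := ⟨hy₀, h01.trans_le h1⟩
  -- A negative value would persist to the left, as `F` increases, and the solution would extend to
  -- `-1`.
  have hpos : ∀ y ∈ Ioo y₀ y₁, 0 < F y + K := by
    intro s hs
    by_contra! hs0
    have hs1 : F s + K < 0 := lt_of_le_of_ne hs0 (hK s hs).1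
    refine hy₀.ne (hmax (-1) y₁ _ le_rfl hy₀.le le_rfl h1
      (H.isSolutionOn_add hν le_rfl h1 fun y hy => ?_) heq).1
    rcases le_or_gt y s with h | h
    · have := hmono.monotoneOn ⟨hy.1, hy.2.trans_le h1⟩ (hI hs) h
      linarith
    · exact (hK y ⟨hs.1.trans h, hy.2⟩).1
  have hpos' : ∀ y ∈ Ioo y₀ 1, 0 < F y + K := by
    intro y hy
    obtain ⟨s, hs0, hs1⟩ := exists_between (lt_min hy.1 h01)
    have hs : s ∈ Ioo y₀ y₁ := ⟨hs0, hs1.trans_le (min_le_right _ _)⟩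
    have := hpos s hs
    have := hmono (hI hs) ⟨hy₀.trans hy.1, hy.2⟩ (hs1.trans_le (min_le_left _ _))
    linarith
  have hy₁ : y₁ = 1 := (hmax y₀ 1 _ hy₀.le le_rfl h1 le_rfl
    (H.isSolutionOn_add hν hy₀.le le_rfl fun y hy => (hpos' y hy).ne') heq).2.symm
  -- If `F + K` did not vanish at `y₀`, the formula would extend the solution slightly to the left.
  have hFc : ContinuousAt F y₀ := (H.hasDerivAt_anti y₀ hy₀').continuousAt
  have hF0 : F y₀ + K = 0 := by
    by_contra hne
    obtain ⟨l, u, ⟨hl, hu⟩, hlu⟩ := mem_nhds_iff_exists_Ioo_subset.1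
      ((hFc.add_const K).eventually_ne hne)
    have hm : max l (-1) < y₀ := max_lt hl hy₀
    refine hm.ne (hmax (max l (-1)) y₁ _ (le_max_right _ _) hm.le le_rfl h1
      (H.isSolutionOn_add hν (le_max_right _ _) h1 fun y hy => ?_) heq).1
    rcases le_or_gt y y₀ with h | h
    · exact hlu ⟨(le_max_left _ _).trans_lt hy.1, h.trans_lt hu⟩
    · exact (hK y ⟨h, hy.2⟩).1
  refine ⟨hy₁, fun y hy => ?_, ?_⟩
  · rw [(hK y hy).2]
    have := one_div_pos.2 (mul_pos (H.pos y (hI hy)) (hpos y hy))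
    linarith
  · have hGc := (H.hasDerivAt_factor y₀ hy₀').continuousAt
    have h0 : Tendsto (fun y => G y * (F y + K)) (𝓝[>] y₀) (𝓝[>] 0) := by
      refine tendsto_nhdsWithin_iff.2 ⟨?_, ?_⟩
      · have := (hGc.mul (hFc.add_const K)).tendsto.mono_left (nhdsWithin_le_nhds (s := Ioi y₀))
        simp only [Pi.mul_apply, hF0, mul_zero] at this
        exact this
      · filter_upwards [Ioo_mem_nhdsGT h01] with y hy
        exact mul_pos (H.pos y (hI hy)) (hpos y hy)
    have hV := (H.sol y₀ hy₀').continuousAt.tendsto.mono_left (nhdsWithin_le_nhds (s := Ioi y₀))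
    refine (hV.add_atTop h0.inv_tendsto_nhdsGT_zero).congr' ?_
    filter_upwards [Ioo_mem_nhdsGT h01] with y hy
    rw [(hK y hy).2, one_div]
    rfl

/-- For `W ≠ V` the function `F + K` is negative throughout, and lowering `K` keeps it so while
moving the solution up towards `V`. -/
theorem exists_of_mem_Icc (H : IsUpper ν c V G F) (hν : 0 < ν) {W : ℝ → ℝ} {γ : ℝ}
    (hW : IsSolutionOn ν c W (-1) 1) (hγ : γ ∈ Icc (W 0) (V 0)) :
    ∃ U, IsSolutionOn ν c U (-1) 1 ∧ U 0 = γ := by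
  have h0 : (0 : ℝ) ∈ Ioo (-1 : ℝ) 1 := by simp
  rcases hγ.2.eq_or_lt with rfl | hlt
  · exact ⟨V, H.isSolutionOn hν, rfl⟩
  rcases H.eqOn_or_exists hν (by norm_num) le_rfl le_rfl hW with hWV | ⟨K, hK⟩
  · linarith [hWV h0, hγ.1]
  have hneg := H.anti_add_neg le_rfl fun y hy => (hK y hy).1
  have hG := H.pos 0 h0
  have hK0 := (hK 0 h0).2
  -- Solves `V 0 + 1/(G 0 (F 0 + M)) = γ`.
  set M := 1 / (G 0 * (γ - V 0)) - F 0 with hM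
  have hMF : F 0 + M = 1 / (G 0 * (γ - V 0)) := by rw [hM]; ring
  have hMK : M ≤ K := by
    have h1 : 1 / (G 0 * (F 0 + K)) = W 0 - V 0 := by linarith
    have h2 : F 0 + K = 1 / (G 0 * (W 0 - V 0)) := by
      rw [← h1]
      have := (hneg 0 h0).ne
      field_simp
    have h3 : F 0 + M ≤ F 0 + K := by
      rw [hMF, h2]
      refine one_div_le_one_div_of_neg_of_le (mul_neg_of_pos_of_neg hG (by linarith)) ?_
      exact mul_le_mul_of_nonneg_left (by linarith [hγ.1]) hG.le
    linarith
  refine ⟨_, H.isSolutionOn_add hν (K := M) le_rfl le_rfl fun y hy => ?_, ?_⟩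
  · linarith [hneg y hy]
  · have : γ - V 0 ≠ 0 := by linarith
    rw [hMF]
    field_simp
    ring

end IsUpper

/-! ### Reflection and the lower solution -/

/-- The parameters of the equation solved by `y ↦ -U (-y)`. -/
def swap (c : ℝ × ℝ × ℝ) : ℝ × ℝ × ℝ := (c.2.1, c.1, c.2.2)

theorem swap_mem_J {ν : ℝ} {c : ℝ × ℝ × ℝ} (hc : c ∈ J ν) : swap c ∈ J ν := by
  refine ⟨hc.2.1, hc.1, ?_⟩
  have := hc.2.2
  simp only [c3bar, swap] at *
  linarith

theorem IsSolutionOn.reflect {ν : ℝ} (hν : 0 < ν) {c : ℝ × ℝ × ℝ} {U : ℝ → ℝ} {a b : ℝ}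
    (ha : -1 ≤ a) (hb : b ≤ 1) (hU : IsSolutionOn ν c U a b) :
    IsSolutionOn ν (swap c) (fun y => -U (-y)) (-b) (-a) := by
  rw [isSolutionOn_iff hν ha hb] at hU
  rw [isSolutionOn_iff hν (by linarith) (by linarith)]
  intro y hy
  have := ((hU (-y) ⟨by linarith [hy.2], by linarith [hy.1]⟩).scomp y (hasDerivAt_neg y)).neg
  refine this.congr_deriv ?_
  simp only [slope, P, swap, neg_sq, smul_eq_mul]
  ring

theorem IsMaximalSolution.reflect {ν : ℝ} (hν : 0 < ν) {c : ℝ × ℝ × ℝ} {U : ℝ → ℝ} {y₀ y₁ : ℝ}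
    (hU : IsMaximalSolution ν c U y₀ y₁) :
    IsMaximalSolution ν (swap c) (fun y => -U (-y)) (-y₁) (-y₀) := by
  obtain ⟨h0, h01, h1, hsol, hmax⟩ := hU
  refine ⟨by linarith, by linarith, by linarith, hsol.reflect hν h0 h1, ?_⟩
  intro a b V ha ha0 hb0 hb hV hVU
  have := hmax (-b) (-a) (fun y => -V (-y)) (by linarith) (by linarith) (by linarith) (by linarith)
    (hV.reflect hν ha hb) fun y hy => by
      have := hVU (x := -y) ⟨by linarith [hy.2], by linarith [hy.1]⟩
      simp only [neg_neg] at this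
      simp [this]
  exact ⟨by linarith [this.2], by linarith [this.1]⟩

/-- The lower solution `W`, with boundary value `τ₁'` at `1`, bounds from below all solutions
defined up to `1`, and the maximal solutions not defined up to `1` blow up to `-∞`. -/
theorem exists_lower {ν : ℝ} (hν : 0 < ν) {c : ℝ × ℝ × ℝ} (hc : c ∈ J ν) :
    ∃ W : ℝ → ℝ, IsSolutionOn ν c W (-1) 1 ∧ Tendsto W (𝓝[<] 1) (𝓝 (tau1' ν c)) ∧
      (∀ (U : ℝ → ℝ) (a : ℝ), -1 ≤ a → a < 1 → IsSolutionOn ν c U a 1 →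
        EqOn U W (Ioo a 1) ∨
          (∀ y ∈ Ioo a 1, W y < U y) ∧ Tendsto U (𝓝[<] 1) (𝓝 (tau2' ν c))) ∧
      ∀ (U : ℝ → ℝ) (y₀ y₁ : ℝ), IsMaximalSolution ν c U y₀ y₁ → y₁ < 1 →
        y₀ = -1 ∧ (∀ y ∈ Ioo y₀ y₁, U y < W y) ∧ Tendsto U (𝓝[<] y₁) atBot := by
  obtain ⟨V, G, F, H⟩ := exists_isUpper hν (swap_mem_J hc)
  have hlim {f : ℝ → ℝ} {a : ℝ} {l : Filter ℝ}
      (h : Tendsto (fun y => -f (-y)) (𝓝[>] (-a)) l) : Tendsto (fun y => -f y) (𝓝[<] a) l :=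
    (h.comp (tendsto_neg_nhdsLT (a := a))).congr fun y => by simp
  have hW : IsSolutionOn ν c (fun y => -V (-y)) (-1) 1 := by
    simpa [swap] using (H.isSolutionOn hν).reflect hν le_rfl le_rfl
  refine ⟨fun y => -V (-y), hW, ?_, ?_, ?_⟩
  · have := (H.tendsto_sol.comp tendsto_neg_nhdsLT).neg
    refine this.trans_eq ?_
    simp only [tau1', tau2, swap]
    ring_nf
  · intro U a ha ha1 hU
    have hU' := hU.reflect hν ha le_rfl
    rcases H.eqOn_or_lt hν (by linarith) (by linarith) hU' with h | ⟨h1, h2⟩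
    · left
      intro y hy
      have := h (x := -y) ⟨by linarith [hy.2], by linarith [hy.1]⟩
      simp only [neg_neg] at this
      linarith
    · right
      refine ⟨fun y hy => ?_, ?_⟩
      · have := h1 (-y) ⟨by linarith [hy.2], by linarith [hy.1]⟩
        simp only [neg_neg] at this
        linarith
      · have := (hlim h2).neg
        simp only [neg_neg] at this
        refine this.trans_eq ?_
        simp only [tau1, tau2', swap]
        ring_nf
  · intro U y₀ y₁ hU hy₁
    obtain ⟨h1, h2, h3⟩ := H.right_of_maximal hν (hU.reflect hν) (by linarith)
    refine ⟨by linarith, fun y hy => ?_, ?_⟩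
    · have := h2 (-y) ⟨by linarith [hy.2], by linarith [hy.1]⟩
      simp only [neg_neg] at this
      linarith
    · exact (tendsto_neg_atTop_atBot.comp (hlim h3)).congr fun y => by simp

end NoSwirl

end

/-! ### The classification -/

theorem proposition3p1 (ν : ℝ) (hν : 0 < ν) (c : ℝ × ℝ × ℝ) (hc : c ∈ NoSwirl.J ν) :
    (NoSwirl.gammaMinus ν c ≤ NoSwirl.gammaPlus ν c ∧
      ∀ γ ∈ Set.Icc (NoSwirl.gammaMinus ν c) (NoSwirl.gammaPlus ν c),
        NoSwirl.IsSolutionOn ν c (NoSwirl.globalSol ν c γ) (-1) 1 ∧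
          NoSwirl.globalSol ν c γ 0 = γ) ∧
    ∀ (y₀ y₁ : ℝ) (U : ℝ → ℝ), NoSwirl.IsMaximalSolution ν c U y₀ y₁ →
      (NoSwirl.CaseGlobal ν c U y₀ y₁ ∧
          ¬ NoSwirl.CaseLeft ν c U y₀ y₁ ∧ ¬ NoSwirl.CaseRight ν c U y₀ y₁) ∨
      (NoSwirl.CaseLeft ν c U y₀ y₁ ∧
          ¬ NoSwirl.CaseGlobal ν c U y₀ y₁ ∧ ¬ NoSwirl.CaseRight ν c U y₀ y₁) ∨
      (NoSwirl.CaseRight ν c U y₀ y₁ ∧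
          ¬ NoSwirl.CaseGlobal ν c U y₀ y₁ ∧ ¬ NoSwirl.CaseLeft ν c U y₀ y₁) := by
  open NoSwirl in
  obtain ⟨V, G, F, H⟩ := exists_isUpper hν hc
  obtain ⟨W, hW, hWlim, hWlow, hWmax⟩ := exists_lower hν hc
  have hV := H.isSolutionOn hν
  have h0 : (0 : ℝ) ∈ Ioo (-1 : ℝ) 1 := by simp
  have h11 : (-1 : ℝ) < 1 := by norm_num
  have hle {U : ℝ → ℝ} (hU : IsSolutionOn ν c U (-1) 1) :
      ∀ y ∈ Ioo (-1 : ℝ) 1, W y ≤ U y ∧ U y ≤ V y := fun y hy =>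
    ⟨(hWlow U (-1) le_rfl h11 hU).elim (fun h => (h hy).ge) fun h => (h.1 y hy).le,
      (H.eqOn_or_lt hν h11 le_rfl hU).elim (fun h => (h hy).le) fun h => (h.1 y hy).le⟩
  have hplus : gammaPlus ν c = V 0 := IsGreatest.csSup_eq
    ⟨⟨V, hV, rfl⟩, by rintro _ ⟨U, hU, rfl⟩; exact (hle hU 0 h0).2⟩
  have hminus : gammaMinus ν c = W 0 := IsLeast.csInf_eq
    ⟨⟨W, hW, rfl⟩, by rintro _ ⟨U, hU, rfl⟩; exact (hle hU 0 h0).1⟩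
  have hglob {γ : ℝ} (hγ : γ ∈ Icc (W 0) (V 0)) :
      IsSolutionOn ν c (globalSol ν c γ) (-1) 1 ∧ globalSol ν c γ 0 = γ := by
    have hex := H.exists_of_mem_Icc hν hW hγ
    rw [globalSol, dif_pos hex]
    exact hex.choose_spec
  -- By uniqueness the choice made in `globalSol` is immaterial on `(-1, 1)`.
  have huniq {U : ℝ → ℝ} (hU : IsSolutionOn ν c U (-1) 1) :
      EqOn (globalSol ν c (U 0)) U (Ioo (-1) 1) := by
    obtain ⟨h1, h2⟩ := hglob (hle hU 0 h0)
    exact H.eqOn_of_eq hν h0 le_rfl le_rfl h1 hU h2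
  have hlower : EqOn (lowerSol ν c) W (Ioo (-1) 1) := by rw [lowerSol, hminus]; exact huniq hW
  have hupper : EqOn (upperSol ν c) V (Ioo (-1) 1) := by rw [upperSol, hplus]; exact huniq hV
  refine ⟨⟨by rw [hplus, hminus]; exact (hle hV 0 h0).1, by rwa [hplus, hminus]⟩, ?_⟩
  intro y₀ y₁ U hU
  obtain ⟨h0', h01, h1', hsol, -⟩ := id hU
  -- The cases have incompatible endpoints, which gives exclusivity.
  rcases h1'.eq_or_lt with rfl | hlt1
  · rcases h0'.eq_or_lt with rfl | hlt0
    · left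
      refine ⟨⟨rfl, rfl, U 0, ?_, (huniq hsol).symm, ?_, ?_⟩, fun h => h.2.2.1.false,
        fun h => h.1.false⟩
      · rw [hplus, hminus]; exact hle hsol 0 h0
      · rw [hplus]
        split_ifs with h
        · refine H.tendsto_sol.congr' ?_
          filter_upwards [Ioo_mem_nhdsGT h11] with y hy using
            (H.eqOn_of_eq hν h0 le_rfl le_rfl hsol hV h hy).symm
        · exact ((H.eqOn_or_lt hν h11 le_rfl hsol).resolve_left fun he => h (he h0)).2
      · rw [hminus]
        split_ifs with h
        · refine hWlim.congr' ?_
          filter_upwards [Ioo_mem_nhdsLT h11] with y hy using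
            (H.eqOn_of_eq hν h0 le_rfl le_rfl hsol hW h hy).symm
        · exact ((hWlow U _ le_rfl h11 hsol).resolve_left fun he => h (he h0)).2
    · right; right
      obtain ⟨-, hgt, htop⟩ := H.right_of_maximal hν hU hlt0
      refine ⟨⟨hlt0, h01, rfl, fun y hy => ?_, ?_, htop⟩, fun h => hlt0.ne' h.1,
        fun h => hlt0.ne' h.1⟩
      · rw [hupper ⟨hlt0.trans hy.1, hy.2⟩]; exact hgt y hy
      · refine ((hWlow U y₀ hlt0.le h01 hsol).resolve_left fun he => ?_).2
        obtain ⟨y, hy⟩ := nonempty_Ioo.2 h01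
        have := (hle hV y ⟨hlt0.trans hy.1, hy.2⟩).1
        linarith [he hy, hgt y hy]
  · right; left
    obtain ⟨rfl, hgt, hbot⟩ := hWmax U y₀ y₁ hU hlt1
    refine ⟨⟨rfl, h01, hlt1, fun y hy => ?_, ?_, hbot⟩, fun h => hlt1.ne h.2.1,
      fun h => h.1.false⟩
    · rw [hlower ⟨hy.1, hy.2.trans hlt1⟩]; exact hgt y hy
    · refine ((H.eqOn_or_lt hν h01 hlt1.le hsol).resolve_left fun he => ?_).2
      obtain ⟨y, hy⟩ := nonempty_Ioo.2 h01
      have := (hle hV y ⟨hy.1, hy.2.trans hlt1⟩).1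
      linarith [he hy, hgt y hy]
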